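/- For integers $\ell\ge 1$ and $0\le j\le \ell$ consider the convergent series \[ A_\ell=\sum_{n=1}^{\infty}\frac{1}{n\left(\exp(2\pi n^{2\ell+1})-1\right)},\qquad B_{\ell,j}=\sum_{n=1}^{\infty}\frac1n\,\mathrm{Re}\left(\frac{1}{\exp\left(2\pi n^{\frac{1}{2\ell+1}}e^{\frac{i\pi j}{2\ell+1}}\right)-1}\right), \] where $n^{1/(2\ell+1)}$ denotes the positive real root. If the set of real numbers \[ \bigcup_{\ell=1}^{\infty}\Big(\{A_\ell\}\cup\{B_{\ell,j}: 0\le j\le \ell\}\Big) \] contains only finitely many transcendental numbers (that is, numbers that are not algebraic over $\mathbb{Q}$), then Euler's constant $\gamma=\lim_{n\to\infty}\left(\sum_{k=1}^{n}\frac1k-\log n\right)$ is transcendental. -/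

import Mathlib

noncomputable section

/-- The series `∑_{n ≥ 1} 1 / (n (exp (2 π n ^ (2ℓ+1)) - 1))`. -/
def lambertOne (l : ℕ) : ℝ :=
  ∑' n : ℕ+, 1 / ((n : ℝ) * (Real.exp (2 * Real.pi * (n : ℝ) ^ (2 * l + 1)) - 1))

/-- The series `∑_{n ≥ 1} (1/n) Re (1 / (exp (2 π n ^ (1/(2ℓ+1)) e ^ (iπj/(2ℓ+1))) - 1))`, where
`n ^ (1/(2ℓ+1))` is the positive real root. -/
def lambertTwo (l j : ℕ) : ℝ :=
  ∑' n : ℕ+, 1 / (n : ℝ) *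
    (1 / (Complex.exp (2 * (Real.pi : ℂ) * (((n : ℝ) ^ (1 / (2 * (l : ℝ) + 1)) : ℝ) : ℂ) *
      Complex.exp (Complex.I * (Real.pi : ℂ) * (j : ℂ) / (2 * (l : ℂ) + 1))) - 1)).re

/-- The set of the values of all these series, over `ℓ ≥ 1` and `0 ≤ j ≤ ℓ`. -/
def lambertValues : Set ℝ :=
  ⋃ l ∈ Set.Ici (1 : ℕ), ({lambertOne l} ∪ {x : ℝ | ∃ j : ℕ, j ≤ l ∧ x = lambertTwo l j})

/-- The series defining `lambertOne l` converges. -/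
theorem summable_lambertOne (l : ℕ) :
    Summable fun n : ℕ+ =>
      1 / ((n : ℝ) * (Real.exp (2 * Real.pi * (n : ℝ) ^ (2 * l + 1)) - 1)) := by
  have h : Summable fun n : ℕ+ => 1 / (n : ℝ) ^ 2 :=
    (Real.summable_one_div_nat_pow.mpr (by norm_num : 1 < 2)).comp_injective PNat.coe_injective
  have key : ∀ n : ℕ+, (n : ℝ) ≤ Real.exp (2 * Real.pi * (n : ℝ) ^ (2 * l + 1)) - 1 := by
    intro n
    have hn : (1 : ℝ) ≤ n := by exact_mod_cast n.pos
    have h1 : (n : ℝ) ≤ (n : ℝ) ^ (2 * l + 1) := le_self_pow₀ hn (by omega)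
    have h2 := Real.add_one_le_exp (2 * Real.pi * (n : ℝ) ^ (2 * l + 1))
    nlinarith [Real.pi_gt_three]
  refine Summable.of_nonneg_of_le (fun n => ?_) (fun n => ?_) h
  · have hn : (0 : ℝ) < n := by exact_mod_cast n.pos
    have := key n
    exact div_nonneg zero_le_one (mul_nonneg hn.le (hn.le.trans this))
  · have hn : (0 : ℝ) < n := by exact_mod_cast n.pos
    have := key n
    rw [pow_two]
    gcongr

/-- The series defining `lambertTwo l j` converges for `j ≤ l`. -/
theorem summable_lambertTwo (l j : ℕ) (hj : j ≤ l) :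
    Summable fun n : ℕ+ => 1 / (n : ℝ) *
      (1 / (Complex.exp (2 * (Real.pi : ℂ) * (((n : ℝ) ^ (1 / (2 * (l : ℝ) + 1)) : ℝ) : ℂ) *
        Complex.exp (Complex.I * (Real.pi : ℂ) * (j : ℂ) / (2 * (l : ℂ) + 1))) - 1)).re := by
  have hs : Summable fun n : ℕ+ => 1 / (n : ℝ) ^ 2 :=
    (Real.summable_one_div_nat_pow.mpr (by norm_num : 1 < 2)).comp_injective PNat.coe_injective
  set t : ℝ := Real.pi * j / (2 * l + 1) with ht
  have hl : (0 : ℝ) < 2 * l + 1 := by positivity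
  have hjl : (j : ℝ) ≤ l := by exact_mod_cast hj
  have hexp : Complex.exp (Complex.I * (Real.pi : ℂ) * (j : ℂ) / (2 * (l : ℂ) + 1))
      = Complex.exp (t * Complex.I) := by
    congr 1; rw [ht]; push_cast; ring
  have hc : 0 < Real.cos t := by
    apply Real.cos_pos_of_mem_Ioo
    constructor
    · have : 0 ≤ t := by positivity
      linarith [Real.pi_pos]
    · rw [ht, div_lt_div_iff₀ hl (by norm_num)]
      nlinarith [Real.pi_pos]
  set c : ℝ := 2 * Real.pi * Real.cos t with hcdef
  have hc0 : 0 < c := by have := Real.pi_pos; positivity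
  set K : ℝ := ((2 * l + 1).factorial : ℝ) / c ^ (2 * l + 1) with hK
  refine Summable.of_norm_bounded (hs.mul_left K) (fun n => ?_)
  have hn : (0 : ℝ) < n := by exact_mod_cast n.pos
  set r : ℝ := (n : ℝ) ^ (1 / (2 * (l : ℝ) + 1)) with hr
  have hr0 : 0 ≤ r := Real.rpow_nonneg hn.le _
  have hrn : r ^ (2 * l + 1) = n := by
    rw [hr, ← Real.rpow_natCast, ← Real.rpow_mul hn.le]
    push_cast
    rw [one_div_mul_cancel hl.ne', Real.rpow_one]
  rw [hexp]
  set z : ℂ := 2 * (Real.pi : ℂ) * (r : ℂ) * Complex.exp (t * Complex.I) with hz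
  have hzre : z.re = c * r := by
    have : z = ((2 * Real.pi * r : ℝ) : ℂ) * Complex.exp (t * Complex.I) := by
      rw [hz]; push_cast; ring
    rw [this, Complex.re_ofReal_mul, Complex.exp_ofReal_mul_I_re, hcdef]; ring
  have hge : (n : ℝ) / K ≤ Real.exp (c * r) - 1 := by
    have h1 := Real.sum_le_exp_of_nonneg (mul_nonneg hc0.le hr0) (2 * l + 2)
    rw [Finset.sum_range_succ, Finset.sum_range_succ'] at h1
    have h2 : 0 ≤ ∑ k ∈ Finset.range (2 * l), (c * r) ^ (k + 1) / ((k + 1).factorial : ℝ) :=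
      Finset.sum_nonneg fun k _ => by positivity
    have h3 : (c * r) ^ (2 * l + 1) / ((2 * l + 1).factorial : ℝ) = n / K := by
      rw [mul_pow, hrn, hK]; field_simp
    simp only [pow_zero, Nat.factorial_zero, Nat.cast_one, div_one] at h1
    linarith
  have hK0 : 0 < K := by positivity
  have hnorm : Real.exp (c * r) - 1 ≤ ‖Complex.exp z - 1‖ := by
    have := norm_sub_norm_le (Complex.exp z) 1
    rwa [Complex.norm_exp, hzre, norm_one] at this
  rw [norm_mul, Real.norm_of_nonneg (by positivity : (0 : ℝ) ≤ 1 / (n : ℝ))]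
  have hre : ‖(1 / (Complex.exp z - 1)).re‖ ≤ K / n := by
    refine (Complex.abs_re_le_norm _).trans ?_
    rw [norm_div, norm_one, ← one_div_div (n : ℝ) K]
    exact one_div_le_one_div_of_le (by positivity) (hge.trans hnorm)
  calc 1 / (n : ℝ) * ‖(1 / (Complex.exp z - 1)).re‖ ≤ 1 / (n : ℝ) * (K / n) := by gcongr
    _ = K * (1 / (n : ℝ) ^ 2) := by field_simp

end

/-! For each `l ≥ 1` there is an exact relation (`lambertOne_eq`): `lambertOne l` equals a nonzero
rational multiple of `π ^ (2l+1)`, minus `l / (2l+1)` times `γ`, plus a rational combination of the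
values `lambertTwo l j`. If `γ` were algebraic and only finitely many of these values
transcendental, all the powers `π ^ (2l+1)` would lie in a finite-dimensional space over the field
of real algebraic numbers. This contradicts the transcendence of `π`, proved here by Lindemann's
method from Hermite-type approximations.

The relation comes from summing `lambertKernel (2 * l) k m` over positive integers in both orders.
Summing over `m`, the partial fractions of the cotangent at `i * k ^ (2l+1)` give the terms of
`lambertOne l`. Summing over `k`, a decomposition over `(2l+1)`-th roots of unity turns the kernel
into the same expansion at the points `m ^ (1/(2l+1)) * exp (iπj/(2l+1))`, giving an alternating
combination of the terms of `lambertTwo l j`.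

The double series does not converge absolutely, so both orders are compared on boxes `K × K ^
(2l+1)`. There the row tails and the column tails tend to the same multiple of `∫₀¹ arctan x / x`
(`tendsto_sum_lambertKernel_sub`). The constant `1/2` in the cotangent expansion leaves harmonic
sums up to `K` and up to `K ^ (2l+1)`; their logarithms cancel and `γ` remains. -/

/-! ### Transcendence of `π`. -/

open Polynomial in
theorem exists_int_polynomial_eval_zero_ne_zero {K : Type*} [Field K] [CharZero K] {β : K}
    (hβ : IsAlgebraic ℤ β) (h0 : β ≠ 0) :
    ∃ f : ℤ[X], f.eval 0 ≠ 0 ∧ aeval β f = 0 := by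
  obtain ⟨f, hf, hf0⟩ := hβ.exists_nonzero_coeff_and_aeval_eq_zero
    (mem_nonZeroDivisors_of_ne_zero h0)
  exact ⟨f, by rwa [← coeff_zero_eq_eval_zero], hf0⟩

open Polynomial in
theorem isIntegral_pow_smul_aeval {A : Type*} [CommRing A] {a : ℤ} {β : A}
    (h : IsIntegral ℤ (a • β)) {g : ℤ[X]} {D : ℕ} (hg : g.natDegree ≤ D) :
    IsIntegral ℤ (a ^ D • aeval β g) := by
  rw [aeval_eq_sum_range' (Nat.lt_succ_of_le hg), Finset.smul_sum]
  refine IsIntegral.sum _ fun i hi => ?_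
  have hi' : i ≤ D := Nat.lt_succ_iff.mp (Finset.mem_range.mp hi)
  have : a ^ D • g.coeff i • β ^ i = (g.coeff i * a ^ (D - i)) • (a • β) ^ i := by
    rw [_root_.smul_pow, smul_smul, smul_smul, mul_assoc, ← pow_add, Nat.sub_add_cancel hi', mul_comm]
  rw [this]
  exact (h.pow i).smul _

theorem exists_int_cast_eq_of_isIntegral_of_fixed {L : Type*} [Field L] [Algebra ℚ L]
    [FiniteDimensional ℚ L] [IsGalois ℚ L] {x : L} (hx : IsIntegral ℤ x)
    (hfix : ∀ σ : L ≃ₐ[ℚ] L, σ x = x) : ∃ z : ℤ, (z : L) = x := by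
  obtain ⟨y, rfl⟩ := (IntermediateField.mem_bot).mp ((IsGalois.mem_bot_iff_fixed x).mpr hfix)
  have hy : IsIntegral ℤ y :=
    (isIntegral_algebraMap_iff (FaithfulSMul.algebraMap_injective ℚ L)).mp hx
  obtain ⟨z, rfl⟩ := IsIntegrallyClosed.isIntegral_iff.mp hy
  exact ⟨z, by simp⟩

theorem tendsto_mul_pow_div_factorial_pred (A C : ℝ) :
    Filter.Tendsto (fun p : ℕ => A * (C ^ p / ((p - 1).factorial : ℝ))) Filter.atTop (nhds 0) := by
  rw [← Filter.tendsto_add_atTop_iff_nat 1]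
  have := (FloorSemiring.tendsto_pow_div_factorial_atTop C).const_mul (A * C)
  rw [mul_zero] at this
  refine this.congr fun n => ?_
  rw [Nat.add_sub_cancel, pow_succ]; ring

-- Expanding the product of `1 + exp (φ (σ α))` over the Galois group gives a vanishing sum of
-- exponentials of the subset sums `β S`. Approximating the exponentials with `β S ≠ 0`
-- simultaneously then yields a nonzero integer of absolute value less than 1.
open Polynomial in
theorem exp_algHom_ne_neg_one {L : Type*} [Field L] [Algebra ℚ L] [FiniteDimensional ℚ L]
    [IsGalois ℚ L] (φ : L →ₐ[ℚ] ℂ) (α : L) : Complex.exp (φ α) ≠ -1 := by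
  classical
  intro hα
  have hLZ : CharZero L := algebraRat.charZero L
  set β : Finset (L ≃ₐ[ℚ] L) → L := fun S => ∑ σ ∈ S, σ α with hβ
  have hsum : ∑ S : Finset (L ≃ₐ[ℚ] L), Complex.exp (φ (β S)) = 0 := by
    have h1 : ∏ σ : L ≃ₐ[ℚ] L, (1 + Complex.exp (φ (σ α))) = 0 :=
      Finset.prod_eq_zero (Finset.mem_univ 1) (by simp [hα])
    rw [Finset.prod_one_add, Finset.powerset_univ] at h1
    rw [← h1]
    refine Finset.sum_congr rfl fun S _ => ?_
    rw [← Complex.exp_sum, hβ, map_sum]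
  set T : Finset (Finset (L ≃ₐ[ℚ] L)) := Finset.univ.filter fun S => β S ≠ 0 with hT
  set q : ℕ := (Finset.univ.filter fun S => ¬ β S ≠ 0).card with hq
  -- The empty subset has sum zero, so the constant term `q` does not vanish.
  have hq0 : 0 < q := Finset.card_pos.mpr ⟨∅, by simp [hβ]⟩
  have hTsum : ∑ S ∈ T, Complex.exp (φ (β S)) = -(q : ℂ) := by
    rw [← Finset.sum_filter_add_sum_filter_not _ (fun S => β S ≠ 0)] at hsum
    have h2 : ∑ S ∈ Finset.univ.filter (fun S => ¬ β S ≠ 0), Complex.exp (φ (β S)) = q := by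
      rw [Finset.sum_congr rfl (g := fun _ => (1 : ℂ))]
      · simp [hq]
      · intro S hS
        have : β S = 0 := by simpa using hS
        simp [this]
    rw [h2] at hsum
    exact eq_neg_of_add_eq_zero_left hsum
  have halg : ∀ x : L, IsAlgebraic ℤ x := fun x =>
    (IsFractionRing.isAlgebraic_iff ℤ ℚ L).mpr (Algebra.IsAlgebraic.isAlgebraic x)
  have hfS : ∀ S ∈ T, ∃ f : ℤ[X], f.eval 0 ≠ 0 ∧ aeval (β S) f = 0 := fun S hS =>
    exists_int_polynomial_eval_zero_ne_zero (halg _) (by simpa [hT] using hS)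
  choose! fS hfS0 hfSβ using hfS
  set f : ℤ[X] := ∏ S ∈ T, fS S with hf
  have hf0 : f.eval 0 ≠ 0 := by
    rw [hf, eval_prod]
    exact Finset.prod_ne_zero_iff.mpr hfS0
  have hfne : f ≠ 0 := by rintro h; simp [h] at hf0
  have hfβ : ∀ S ∈ T, aeval (β S) f = 0 := fun S hS => by
    rw [hf, map_prod]
    exact Finset.prod_eq_zero hS (hfSβ S hS)
  have hroot : ∀ S ∈ T, φ (β S) ∈ f.aroots ℂ := fun S hS => by
    rw [mem_aroots]
    refine ⟨hfne, ?_⟩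
    have := congrArg φ (hfβ S hS)
    rw [map_zero] at this
    rw [← this]
    exact Polynomial.aeval_algHom_apply (φ.restrictScalars ℤ) (β S) f
  obtain ⟨a, ha0, ha⟩ : ∃ a : ℤ, a ≠ 0 ∧ ∀ S, IsIntegral ℤ (a • β S) := by
    have : Algebra.IsAlgebraic ℤ L := ⟨halg⟩
    obtain ⟨a, ha0, ha⟩ := Algebra.IsAlgebraic.exists_integral_multiples ℤ
      (Finset.univ.image β)
    exact ⟨a, ha0, fun S => ha _ (Finset.mem_image_of_mem _ (Finset.mem_univ S))⟩
  obtain ⟨c, hc⟩ := LindemannWeierstrass.exp_polynomial_approx f hf0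
  have hlim := tendsto_mul_pow_div_factorial_pred (T.card : ℝ) (|(a : ℝ)| ^ f.natDegree * c)
  obtain ⟨N, hN⟩ := Filter.eventually_atTop.mp (hlim.eventually (gt_mem_nhds one_pos))
  -- `p` exceeds `|f(0)|` for the approximation, `q` and `|a|` for indivisibility, and `N` for
  -- smallness.
  obtain ⟨p, hpN, hp⟩ :=
    Nat.exists_infinite_primes (max N ((f.eval 0).natAbs + q + a.natAbs + 1))
  have hpN' := hN p (le_trans (le_max_left _ _) hpN)
  have hpge := le_trans (le_max_right _ _) hpN
  obtain ⟨n, hpn, g, hgdeg, hg⟩ := hc p (by omega) hp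
  set D := p * f.natDegree with hD
  have hgD : g.natDegree ≤ D := hgdeg.trans (Nat.sub_le _ _)
  -- The sum is an algebraic integer, and left translation by `τ` permutes the subsets in `T`, so it
  -- is Galois-invariant.
  obtain ⟨z, hz⟩ : ∃ z : ℤ, (z : L) = ∑ S ∈ T, a ^ D • aeval (β S) g := by
    apply exists_int_cast_eq_of_isIntegral_of_fixed
    · exact IsIntegral.sum _ fun S _ => isIntegral_pow_smul_aeval (ha S) hgD
    · intro τ
      have hτβ : ∀ S, β (S.image (τ * ·)) = τ (β S) := fun S => by
        simp only [hβ]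
        rw [Finset.sum_image (fun _ _ _ _ h => mul_left_cancel h), map_sum]
        rfl
      rw [map_sum]
      refine Finset.sum_bij' (fun S _ => S.image (τ * ·)) (fun S _ => S.image (τ⁻¹ * ·))
        ?_ ?_ ?_ ?_ ?_
      · intro S hS
        simp only [hT, Finset.mem_filter, Finset.mem_univ, true_and] at hS ⊢
        rw [hτβ]; simpa using hS
      · intro S hS
        simp only [hT, Finset.mem_filter, Finset.mem_univ, true_and] at hS ⊢
        intro h0
        apply hS
        have := hτβ (S.image (τ⁻¹ * ·))
        rw [h0, map_zero, Finset.image_image] at this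
        simpa [Function.comp_def] using this
      · intro S _; rw [Finset.image_image]; simp [Function.comp_def]
      · intro S _; rw [Finset.image_image]; simp [Function.comp_def]
      · intro S _
        rw [map_zsmul, hτβ]
        congr 1
        exact (Polynomial.aeval_algHom_apply ((τ : L →ₐ[ℚ] L).restrictScalars ℤ) (β S) g).symm
  have hz' : (z : ℂ) = ∑ S ∈ T, (a : ℂ) ^ D * aeval (φ (β S)) g := by
    have := congrArg φ hz
    rw [map_intCast, map_sum] at this
    rw [this]
    refine Finset.sum_congr rfl fun S _ => ?_
    rw [map_zsmul, zsmul_eq_mul, Int.cast_pow]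
    congr 1
    exact (Polynomial.aeval_algHom_apply (φ.restrictScalars ℤ) (β S) g).symm
  -- Modulo `p` only `a ^ D * n * q` survives, and `p` divides none of its factors.
  have hne : a ^ D * n * q + p * z ≠ 0 := by
    intro h
    have hdvd : (p : ℤ) ∣ a ^ D * n * q := ⟨-z, by linarith⟩
    have hpp := Nat.prime_iff_prime_int.mp hp
    rcases hpp.dvd_or_dvd hdvd with h | h
    · rcases hpp.dvd_or_dvd h with h | h
      · have := Int.natAbs_dvd_natAbs.mpr (hpp.dvd_of_dvd_pow h)
        have := Nat.le_of_dvd (Int.natAbs_pos.mpr ha0) this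
        simp only [Int.natAbs_natCast] at this
        omega
      · exact hpn h
    · have := Nat.le_of_dvd hq0 (Int.natCast_dvd_natCast.mp h)
      omega
  have hval : ((a ^ D * n * q + p * z : ℤ) : ℂ) =
      -((a : ℂ) ^ D * ∑ S ∈ T, (n • Complex.exp (φ (β S)) - p • aeval (φ (β S)) g)) := by
    push_cast
    rw [hz', Finset.sum_sub_distrib, ← Finset.smul_sum, ← Finset.smul_sum, hTsum,
      ← Finset.mul_sum, zsmul_eq_mul, nsmul_eq_mul]
    ring
  have hle : ‖((a ^ D * n * q + p * z : ℤ) : ℂ)‖ ≤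
      T.card * ((|(a : ℝ)| ^ f.natDegree * c) ^ p / ((p - 1).factorial : ℝ)) := by
    rw [hval, norm_neg, norm_mul, norm_pow, Complex.norm_intCast]
    calc _ ≤ |(a : ℝ)| ^ D * ∑ S ∈ T, c ^ p / ((p - 1).factorial : ℝ) := by
          gcongr
          exact (norm_sum_le _ _).trans (Finset.sum_le_sum fun S hS => hg (hroot S hS))
      _ = _ := by
          rw [Finset.sum_const, nsmul_eq_mul, mul_pow, ← pow_mul, hD, mul_comm p]; ring
  rw [Complex.norm_intCast] at hle
  have : (1 : ℝ) ≤ |((a ^ D * n * q + p * z : ℤ) : ℝ)| := by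
    exact_mod_cast Int.one_le_abs hne
  linarith

/-- In the splitting field of the minimal polynomial of `x`, any root `y` has that same minimal
polynomial, so some embedding sends `y` to `x`. -/
theorem exists_isGalois_algHom_apply_eq.{u, v} {F : Type u} {K : Type v} [Field F] [CharZero F] [Field K]
    [Algebra F K] [IsAlgClosed K] {x : K} (hx : IsIntegral F x) :
    ∃ (L : Type u) (_ : Field L) (_ : Algebra F L) (φ : L →ₐ[F] K) (y : L),
      FiniteDimensional F L ∧ IsGalois F L ∧ φ y = x := by
  set P := minpoly F x with hPx
  have hP : Irreducible P := minpoly.irreducible hx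
  have : Normal F P.SplittingField := Normal.of_isSplittingField P
  have : IsGalois F P.SplittingField := ⟨⟩
  obtain ⟨y, hy⟩ := Polynomial.Splits.exists_eval_eq_zero (Polynomial.SplittingField.splits P)
    (by rw [Polynomial.degree_map]; exact hP.degree_pos.ne')
  rw [Polynomial.eval_map_algebraMap] at hy
  have hmin : minpoly F y = P :=
    (minpoly.eq_of_irreducible_of_monic hP hy (minpoly.monic hx)).symm
  have hmem : x ∈ (minpoly F y).rootSet K := by
    rw [hmin, Polynomial.mem_rootSet]
    exact ⟨hP.ne_zero, minpoly.aeval F x⟩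
  rw [← Algebra.IsAlgebraic.range_eval_eq_rootSet_minpoly K y] at hmem
  obtain ⟨φ, hφ⟩ := hmem
  exact ⟨P.SplittingField, inferInstance, inferInstance, φ, y, inferInstance, inferInstance, hφ⟩

theorem exp_ne_neg_one_of_isAlgebraic {x : ℂ} (hx : IsAlgebraic ℚ x) : Complex.exp x ≠ -1 := by
  obtain ⟨L, _, _, φ, y, _, _, rfl⟩ := exists_isGalois_algHom_apply_eq hx.isIntegral
  exact exp_algHom_ne_neg_one φ y

theorem transcendental_pi : Transcendental ℚ Real.pi := by
  intro h
  have h1 : IsAlgebraic ℚ (Real.pi : ℂ) := h.algebraMap (A := ℂ)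
  have h2 : IsAlgebraic ℚ Complex.I :=
    ⟨Polynomial.X ^ 2 + 1, by
      intro h
      have := congrArg (Polynomial.eval 0) h
      simp at this, by simp⟩
  exact exp_ne_neg_one_of_isAlgebraic (h1.mul h2) Complex.exp_pi_mul_I

/-! ### Comparison of sums with integrals. -/

open Filter Topology

/-- By the mean value theorem each unit increment of `Φ` lies between two consecutive values of `f`.
The increments telescope, and the lower and upper sums differ by `f a`. -/
theorem AntitoneOn.abs_tsum_sub_le_of_hasDerivAt {f Φ : ℝ → ℝ} {a L : ℝ}
    (hf : AntitoneOn f (Set.Ici a)) (hf0 : ∀ x, a ≤ x → 0 ≤ f x)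
    (hΦ : ∀ x, a ≤ x → HasDerivAt Φ (f x) x) (hL : Tendsto Φ atTop (𝓝 L)) :
    Summable (fun i : ℕ => f (a + i + 1)) ∧ |∑' i : ℕ, f (a + i + 1) - (L - Φ a)| ≤ f a := by
  have hmvt : ∀ i : ℕ, f (a + i + 1) ≤ Φ (a + i + 1) - Φ (a + i) ∧
      Φ (a + i + 1) - Φ (a + i) ≤ f (a + i) := by
    intro i
    have hi : (0 : ℝ) ≤ i := i.cast_nonneg
    obtain ⟨c, hc, hc'⟩ := exists_hasDerivAt_eq_slope Φ f (a := a + i) (b := a + i + 1)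
      (by linarith)
      (fun x hx => (hΦ x (by linarith [hx.1])).continuousAt.continuousWithinAt)
      (fun x hx => hΦ x (by linarith [hx.1]))
    rw [add_sub_cancel_left, div_one] at hc'
    rw [← hc']
    exact ⟨hf (Set.mem_Ici.mpr (by linarith [hc.1])) (Set.mem_Ici.mpr (by linarith)) hc.2.le,
      hf (Set.mem_Ici.mpr (by linarith)) (Set.mem_Ici.mpr (by linarith [hc.1])) hc.1.le⟩
  have hnn : ∀ i : ℕ, 0 ≤ f (a + i + 1) := fun i => hf0 _ (by
    have : (0 : ℝ) ≤ i := i.cast_nonneg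
    linarith)
  have htel : HasSum (fun i : ℕ => Φ (a + i + 1) - Φ (a + i)) (L - Φ a) := by
    rw [hasSum_iff_tendsto_nat_of_nonneg fun i => (hnn i).trans (hmvt i).1]
    have h1 : ∀ n : ℕ, ∑ i ∈ Finset.range n, (Φ (a + i + 1) - Φ (a + i)) = Φ (a + n) - Φ a := by
      intro n
      have := Finset.sum_range_sub (fun i : ℕ => Φ (a + i)) n
      simpa [add_assoc] using this
    simp_rw [h1]
    exact (hL.comp (tendsto_atTop_add_const_left _ a tendsto_natCast_atTop_atTop)).sub_const _
  have hsum : Summable (fun i : ℕ => f (a + i + 1)) :=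
    Summable.of_nonneg_of_le hnn (fun i => (hmvt i).1) htel.summable
  have hsum' : Summable (fun i : ℕ => f (a + i)) := by
    rw [← summable_nat_add_iff 1]
    simpa [add_assoc] using hsum
  refine ⟨hsum, ?_⟩
  have h1 : ∑' i : ℕ, f (a + i + 1) ≤ L - Φ a := by
    rw [← htel.tsum_eq]; exact hsum.tsum_le_tsum (fun i => (hmvt i).1) htel.summable
  have h2 : L - Φ a ≤ f a + ∑' i : ℕ, f (a + i + 1) := by
    have h3 : ∑' i : ℕ, f (a + i) = f a + ∑' i : ℕ, f (a + i + 1) := by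
      rw [hsum'.tsum_eq_zero_add]; simp [add_assoc]
    rw [← htel.tsum_eq, ← h3]; exact htel.summable.tsum_le_tsum (fun i => (hmvt i).2) hsum'
  rw [abs_le]; constructor <;> linarith [hf0 a le_rfl]

theorem Continuous.tendsto_riemann_sum {f : ℝ → ℝ} (hf : Continuous f) :
    Tendsto (fun n : ℕ => ∑ i ∈ Finset.range n, f ((i + 1) / n) / n) atTop
      (𝓝 (∫ x in (0 : ℝ)..1, f x)) := by
  have huc : UniformContinuousOn f (Set.Icc 0 1) :=
    isCompact_Icc.uniformContinuousOn_of_continuous hf.continuousOn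
  rw [Metric.tendsto_atTop]
  intro ε hε
  obtain ⟨δ, hδ, h⟩ := Metric.uniformContinuousOn_iff.mp huc (ε / 2) (by positivity)
  obtain ⟨n₀, hn₀⟩ := exists_nat_one_div_lt hδ
  refine ⟨n₀ + 1, fun n hn => ?_⟩
  have hn0 : (0 : ℝ) < n := by exact_mod_cast (Nat.succ_pos n₀).trans_le hn
  have hnδ : 1 / (n : ℝ) < δ := by
    refine lt_of_le_of_lt ?_ hn₀
    apply one_div_le_one_div_of_le (by positivity)
    exact_mod_cast hn
  have hint : ∫ x in (0 : ℝ)..1, f x =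
      ∑ i ∈ Finset.range n, ∫ x in ((i : ℕ) / n : ℝ)..((i + 1 : ℕ) / n : ℝ), f x := by
    rw [intervalIntegral.sum_integral_adjacent_intervals
      (fun k _ => hf.intervalIntegrable _ _)]
    simp [hn0.ne']
  rw [hint, Real.dist_eq, ← Finset.sum_sub_distrib]
  have hterm : ∀ i ∈ Finset.range n, |f ((i + 1) / n) / n -
      ∫ x in ((i : ℕ) / n : ℝ)..((i + 1 : ℕ) / n : ℝ), f x| ≤ ε / 2 * (1 / n) := by
    intro i hi
    have hi' : (i : ℝ) + 1 ≤ n := by exact_mod_cast Finset.mem_range.mp hi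
    have hlen : ((i + 1 : ℕ) / n : ℝ) - (i : ℕ) / n = 1 / n := by push_cast; field_simp; ring
    have hc : f ((i + 1) / n) / n =
        ∫ x in ((i : ℕ) / n : ℝ)..((i + 1 : ℕ) / n : ℝ), f ((i + 1) / n) := by
      rw [intervalIntegral.integral_const, hlen, smul_eq_mul]; ring
    rw [hc, ← intervalIntegral.integral_sub (by simp) (hf.intervalIntegrable _ _)]
    have := intervalIntegral.norm_integral_le_of_norm_le_const (a := ((i : ℕ) / n : ℝ))
      (b := ((i + 1 : ℕ) / n : ℝ)) (f := fun x => f ((i + 1) / n) - f x) (C := ε / 2) ?_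
    · rwa [hlen, abs_of_pos (by positivity : 0 < 1 / (n : ℝ))] at this
    · intro x hx
      rw [Set.uIoc_of_le (by linarith [hlen, (by positivity : 0 < 1 / (n : ℝ))])] at hx
      have h0 : (0 : ℝ) ≤ (i : ℕ) / n := by positivity
      have h1 : ((i + 1 : ℕ) / n : ℝ) ≤ 1 := by rw [div_le_one hn0]; exact_mod_cast hi'
      have he : ((i : ℝ) + 1) / n = ((i + 1 : ℕ) / n : ℝ) := by push_cast; rfl
      rw [he]
      refine (h _ ⟨by linarith [hx.1, hx.2], h1⟩ _ ⟨by linarith [hx.1], by linarith [hx.2]⟩ ?_).le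
      rw [Real.dist_eq, abs_of_nonneg (by linarith [hx.2])]
      linarith [hx.1]
  calc _ ≤ ∑ i ∈ Finset.range n, ε / 2 * (1 / n) :=
        (Finset.abs_sum_le_sum_abs _ _).trans (Finset.sum_le_sum hterm)
    _ = ε / 2 := by rw [Finset.sum_const, Finset.card_range, nsmul_eq_mul]; field_simp
    _ < ε := by linarith

/-- `dslope` extends `arctan x / x` continuously to `0`, so that the Riemann sums below have a
continuous integrand. -/
theorem continuous_dslope_arctan : Continuous (dslope Real.arctan 0) := by
  rw [← continuousOn_univ, continuousOn_dslope Filter.univ_mem]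
  exact ⟨Real.continuous_arctan.continuousOn, Real.differentiable_arctan.differentiableAt⟩

theorem dslope_arctan_of_ne {x : ℝ} (hx : x ≠ 0) :
    dslope Real.arctan 0 x = Real.arctan x / x := by
  rw [dslope_of_ne _ hx, slope_def_field]; simp

/-- The substitution `u = x ^ (n + 1)` identifies the limit of the row tails with that of the column
tails. -/
theorem integral_pow_mul_comp_pow {g : ℝ → ℝ} (hg : Continuous g) (n : ℕ) :
    ∫ x in (0 : ℝ)..1, x ^ n * g (x ^ (n + 1)) = (∫ x in (0 : ℝ)..1, g x) / (n + 1) := by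
  have h := intervalIntegral.integral_comp_mul_deriv (a := 0) (b := 1)
    (f := fun x : ℝ => x ^ (n + 1)) (f' := fun x => ((n + 1 : ℕ) : ℝ) * x ^ n) (g := g)
    (fun x _ => by simpa using hasDerivAt_pow (n + 1) x) (by fun_prop) hg
  simp only [Function.comp_def, one_pow, zero_pow n.succ_ne_zero] at h
  rw [← h, eq_div_iff (by positivity), ← intervalIntegral.integral_mul_const]
  congr 1; ext x; push_cast; ring

/-! ### The kernel and its two iterated sums. -/

/-- The kernel `x ^ n / (x ^ (2n+2) + y ^ 2)` of a conditionally convergent double series. -/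
noncomputable def lambertKernel (n : ℕ) (x y : ℝ) : ℝ := x ^ n / (x ^ (2 * n + 2) + y ^ 2)

theorem lambertKernel_nonneg (n : ℕ) {x : ℝ} (hx : 0 ≤ x) (y : ℝ) : 0 ≤ lambertKernel n x y := by
  unfold lambertKernel; positivity

theorem lambertKernel_le (n : ℕ) {x : ℝ} (hx : 0 < x) (y : ℝ) :
    lambertKernel n x y ≤ x ^ n / x ^ (2 * n + 2) := by
  unfold lambertKernel
  gcongr
  nlinarith [sq_nonneg y]

/-- In `y`, the kernel is decreasing with antiderivative `arctan (y / x ^ (n + 1)) / x`. -/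
theorem lambertKernel_row_tail (n : ℕ) {x a : ℝ} (hx : 0 < x) (ha : 0 < a) :
    Summable (fun i : ℕ => lambertKernel n x (a + i + 1)) ∧
      |∑' i : ℕ, lambertKernel n x (a + i + 1) - x⁻¹ * Real.arctan (x ^ (n + 1) / a)| ≤
        lambertKernel n x a := by
  have hxn : 0 < x ^ (n + 1) := by positivity
  have hlim : Tendsto (fun y : ℝ => x⁻¹ * Real.arctan (y / x ^ (n + 1))) atTop
      (𝓝 (x⁻¹ * (Real.pi / 2))) :=
    ((tendsto_nhds_of_tendsto_nhdsWithin Real.tendsto_arctan_atTop).comp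
      (tendsto_id.atTop_div_const hxn)).const_mul _
  have hmain := AntitoneOn.abs_tsum_sub_le_of_hasDerivAt (f := lambertKernel n x)
    (Φ := fun y => x⁻¹ * Real.arctan (y / x ^ (n + 1))) (a := a) ?_
    (fun y _ => lambertKernel_nonneg n hx.le y) ?_ hlim
  · have hL : x⁻¹ * (Real.pi / 2) - x⁻¹ * Real.arctan (a / x ^ (n + 1)) =
        x⁻¹ * Real.arctan (x ^ (n + 1) / a) := by
      rw [← mul_sub, ← Real.arctan_inv_of_pos (by positivity), inv_div]
    rwa [hL] at hmain
  · intro y hy z hz hyz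
    have hy0 : 0 < y := ha.trans_le hy
    unfold lambertKernel
    gcongr
  · intro y _
    have h := ((hasDerivAt_id y).div_const (x ^ (n + 1))).arctan.const_mul x⁻¹
    convert! h using 1
    unfold lambertKernel
    have h1 : x ^ (2 * n + 2) = (x ^ (n + 1)) ^ 2 := by rw [← pow_mul]; ring_nf
    have h2 : (x ^ (n + 1)) ^ 2 + y ^ 2 ≠ 0 := by positivity
    simp only [id_eq]
    rw [h1]
    field_simp
    ring

/-- In `x` the derivative has the sign of `n * y ^ 2 - (n + 2) * x ^ (2 * n + 2)`; the condition on
`a` ensures that it is not positive from `a` on. -/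
theorem lambertKernel_antitoneOn (n : ℕ) {y a : ℝ} (ha : 0 < a) (hy : 0 < y)
    (hya : y ≤ a ^ (n + 1)) :
    AntitoneOn (fun x => lambertKernel n x y) (Set.Ici a) := by
  intro u hu v hv huv
  have hu0 : 0 < u := ha.trans_le hu
  have hv0 : 0 < v := ha.trans_le hv
  simp only [lambertKernel]
  rw [div_le_div_iff₀ (by positivity) (by positivity)]
  have hyu : y ^ 2 ≤ u ^ n * u ^ (n + 2) := by
    have : y ≤ u ^ (n + 1) := hya.trans (by gcongr; exact hu)
    calc y ^ 2 ≤ (u ^ (n + 1)) ^ 2 := by gcongr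
      _ = _ := by ring
  have hpq : u ^ n ≤ v ^ n := by gcongr
  have hUV : u ^ 2 ≤ v ^ 2 := by gcongr
  have h1 : y ^ 2 * (v ^ n - u ^ n) ≤ u ^ n * u ^ (n + 2) * (v ^ n - u ^ n) :=
    mul_le_mul_of_nonneg_right hyu (sub_nonneg.mpr hpq)
  have h2 : 0 ≤ u ^ n * (v ^ n) ^ 2 * (v ^ 2 - u ^ 2) :=
    mul_nonneg (by positivity) (sub_nonneg.mpr hUV)
  have h3 : 0 ≤ u ^ n * u ^ 2 * (v ^ n - u ^ n) ^ 2 := by positivity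
  have h4 : u ^ (n + 2) = u ^ n * u ^ 2 := by ring
  have h5 : u ^ (2 * n + 2) = u ^ n * u ^ n * u ^ 2 := by ring
  have h6 : v ^ (2 * n + 2) = v ^ n * v ^ n * v ^ 2 := by ring
  rw [h4] at h1
  rw [h5, h6]
  linarith

theorem lambertKernel_column_tail (n : ℕ) {y a : ℝ} (ha : 0 < a) (hy : 0 < y)
    (hya : y ≤ a ^ (n + 1)) :
    Summable (fun i : ℕ => lambertKernel n (a + i + 1) y) ∧
      |∑' i : ℕ, lambertKernel n (a + i + 1) y -
        ((n + 1) * y)⁻¹ * Real.arctan (y / a ^ (n + 1))| ≤ lambertKernel n a y := by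
  have hlim : Tendsto (fun x : ℝ => ((n + 1) * y)⁻¹ * Real.arctan (x ^ (n + 1) / y)) atTop
      (𝓝 (((n + 1) * y)⁻¹ * (Real.pi / 2))) :=
    ((tendsto_nhds_of_tendsto_nhdsWithin Real.tendsto_arctan_atTop).comp
      ((tendsto_pow_atTop n.succ_ne_zero).atTop_div_const hy)).const_mul _
  have hmain := AntitoneOn.abs_tsum_sub_le_of_hasDerivAt (f := fun x => lambertKernel n x y)
    (Φ := fun x => ((n + 1) * y)⁻¹ * Real.arctan (x ^ (n + 1) / y)) (a := a)
    (lambertKernel_antitoneOn n ha hy hya)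
    (fun x hx => lambertKernel_nonneg n (ha.le.trans hx) y) ?_ hlim
  · have hL : ((n + 1) * y)⁻¹ * (Real.pi / 2) - ((n + 1) * y)⁻¹ * Real.arctan (a ^ (n + 1) / y) =
        ((n + 1) * y)⁻¹ * Real.arctan (y / a ^ (n + 1)) := by
      rw [← mul_sub, ← Real.arctan_inv_of_pos (by positivity), inv_div]
    rwa [hL] at hmain
  · intro x hx
    have hx0 : 0 < x := ha.trans_le hx
    have h := ((hasDerivAt_pow (n + 1) x).div_const y).arctan.const_mul ((n + 1) * y)⁻¹
    convert! h using 1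
    unfold lambertKernel
    have h1 : x ^ (2 * n + 2) = (x ^ (n + 1)) ^ 2 := by rw [← pow_mul]; ring_nf
    have hn : (n : ℝ) + 1 ≠ 0 := by positivity
    rw [h1, Nat.add_sub_cancel, Nat.cast_add_one, div_pow]
    rw [one_add_div (by positivity)]
    field_simp
    ring

theorem summable_lambertKernel_row (n : ℕ) {x : ℝ} (hx : 0 < x) :
    Summable (fun i : ℕ => lambertKernel n x (i + 1)) := by
  rw [← summable_nat_add_iff 1]
  refine (lambertKernel_row_tail n hx one_pos).1.congr fun i => ?_
  push_cast; ring_nf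

theorem summable_lambertKernel_column (n : ℕ) {y : ℝ} (hy : 0 < y) :
    Summable (fun i : ℕ => lambertKernel n (i + 1) y) := by
  -- Starting at `K + 1 ≥ y` places the tail where the kernel decreases.
  obtain ⟨K, hK⟩ := exists_nat_ge y
  have hy' : y ≤ ((K + 1 : ℕ) : ℝ) ^ (n + 1) := by
    have h1 : y ≤ ((K + 1 : ℕ) : ℝ) := by push_cast; linarith
    exact h1.trans (le_self_pow₀ (by push_cast; linarith [(K.cast_nonneg : (0 : ℝ) ≤ K)])
      n.succ_ne_zero)
  rw [← summable_nat_add_iff (K + 1)]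
  refine (lambertKernel_column_tail n (by positivity) hy hy').1.congr fun i => ?_
  push_cast; ring_nf

/-- Each tail is `arctan ((k/K) ^ (n+1)) / k`, a Riemann term of mesh `1/K`, up to `K⁻²`; there are
`K` rows. -/
theorem tendsto_sum_lambertKernel_row_tail (n : ℕ) :
    Tendsto (fun K : ℕ => ∑ k ∈ Finset.range K,
        ∑' i : ℕ, lambertKernel n ((k : ℝ) + 1) ((K : ℝ) ^ (n + 1) + i + 1)) atTop
      (𝓝 ((∫ x in (0 : ℝ)..1, dslope Real.arctan 0 x) / (n + 1))) := by
  have hcont : Continuous fun x : ℝ => x ^ n * dslope Real.arctan 0 (x ^ (n + 1)) := by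
    have := continuous_dslope_arctan
    fun_prop
  have hR := hcont.tendsto_riemann_sum
  rw [integral_pow_mul_comp_pow continuous_dslope_arctan] at hR
  refine hR.congr_dist ?_
  refine squeeze_zero' (Eventually.of_forall fun _ => dist_nonneg) ?_
    (tendsto_inv_atTop_nhds_zero_nat (𝕜 := ℝ))
  filter_upwards [eventually_ge_atTop 1] with K hK
  have hK0 : (0 : ℝ) < K := by exact_mod_cast hK
  have hK1 : (1 : ℝ) ≤ K := by exact_mod_cast hK
  rw [dist_comm, Real.dist_eq, ← Finset.sum_sub_distrib]
  have hterm : ∀ k ∈ Finset.range K,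
      |∑' i : ℕ, lambertKernel n ((k : ℝ) + 1) ((K : ℝ) ^ (n + 1) + i + 1) -
        (((k : ℝ) + 1) / K) ^ n * dslope Real.arctan 0 ((((k : ℝ) + 1) / K) ^ (n + 1)) / K| ≤
      (K : ℝ)⁻¹ ^ 2 := by
    intro k hk
    have hk' : (k : ℝ) + 1 ≤ K := by exact_mod_cast Finset.mem_range.mp hk
    have hk0 : (0 : ℝ) < (k : ℝ) + 1 := by positivity
    have h := (lambertKernel_row_tail n hk0 (pow_pos hK0 (n + 1))).2
    have he : (((k : ℝ) + 1) / K) ^ n * dslope Real.arctan 0 ((((k : ℝ) + 1) / K) ^ (n + 1)) / K =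
        ((k : ℝ) + 1)⁻¹ * Real.arctan (((k : ℝ) + 1) ^ (n + 1) / (K : ℝ) ^ (n + 1)) := by
      rw [dslope_arctan_of_ne (by positivity), div_pow, div_pow]
      field_simp
      ring
    rw [he]
    refine h.trans ?_
    unfold lambertKernel
    calc ((k : ℝ) + 1) ^ n / (((k : ℝ) + 1) ^ (2 * n + 2) + ((K : ℝ) ^ (n + 1)) ^ 2)
        ≤ (K : ℝ) ^ n / (((K : ℝ) ^ (n + 1)) ^ 2) := by
          gcongr
          have : 0 ≤ ((k : ℝ) + 1) ^ (2 * n + 2) := by positivity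
          linarith
      _ = ((K : ℝ) ^ (n + 2))⁻¹ := by field_simp; ring
      _ ≤ ((K : ℝ) ^ 2)⁻¹ := by gcongr; omega
      _ = _ := by rw [inv_pow]
  calc _ ≤ ∑ k ∈ Finset.range K, (K : ℝ)⁻¹ ^ 2 :=
        (Finset.abs_sum_le_sum_abs _ _).trans (Finset.sum_le_sum hterm)
    _ = (K : ℝ)⁻¹ := by rw [Finset.sum_const, Finset.card_range, nsmul_eq_mul]; field_simp

/-- Here the mesh is `1 / K ^ (n + 1)`, and each of the `K ^ (n + 1)` columns contributes an error
at most `1 / K ^ (n + 2)`. -/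
theorem tendsto_sum_lambertKernel_column_tail (n : ℕ) :
    Tendsto (fun K : ℕ => ∑ m ∈ Finset.range (K ^ (n + 1)),
        ∑' i : ℕ, lambertKernel n ((K : ℝ) + i + 1) ((m : ℝ) + 1)) atTop
      (𝓝 ((∫ x in (0 : ℝ)..1, dslope Real.arctan 0 x) / (n + 1))) := by
  have hR := (continuous_dslope_arctan.tendsto_riemann_sum.comp
    (tendsto_pow_atTop (α := ℕ) n.succ_ne_zero)).div_const ((n : ℝ) + 1)
  refine hR.congr_dist ?_
  refine squeeze_zero' (Eventually.of_forall fun _ => dist_nonneg) ?_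
    (tendsto_inv_atTop_nhds_zero_nat (𝕜 := ℝ))
  filter_upwards [eventually_ge_atTop 1] with K hK
  have hK0 : (0 : ℝ) < K := by exact_mod_cast hK
  simp only [Function.comp_def]
  rw [dist_comm, Real.dist_eq, Finset.sum_div, ← Finset.sum_sub_distrib]
  have hterm : ∀ m ∈ Finset.range (K ^ (n + 1)),
      |∑' i : ℕ, lambertKernel n ((K : ℝ) + i + 1) ((m : ℝ) + 1) -
        dslope Real.arctan 0 (((m : ℝ) + 1) / ((K ^ (n + 1) : ℕ) : ℝ)) / ((K ^ (n + 1) : ℕ) : ℝ) /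
          (n + 1)| ≤ ((K : ℝ) ^ (n + 2))⁻¹ := by
    intro m hm
    have hm' : (m : ℝ) + 1 ≤ (K : ℝ) ^ (n + 1) := by exact_mod_cast Finset.mem_range.mp hm
    have hm0 : (0 : ℝ) < (m : ℝ) + 1 := by positivity
    have h := (lambertKernel_column_tail n hK0 hm0 hm').2
    have he : dslope Real.arctan 0 (((m : ℝ) + 1) / ((K ^ (n + 1) : ℕ) : ℝ)) /
          ((K ^ (n + 1) : ℕ) : ℝ) / (n + 1) =
        (((n : ℝ) + 1) * ((m : ℝ) + 1))⁻¹ * Real.arctan (((m : ℝ) + 1) / (K : ℝ) ^ (n + 1)) := by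
      push_cast
      rw [dslope_arctan_of_ne (by positivity)]
      field_simp
    rw [he]
    refine h.trans ((lambertKernel_le n hK0 _).trans (le_of_eq ?_))
    field_simp; ring
  calc _ ≤ ∑ m ∈ Finset.range (K ^ (n + 1)), ((K : ℝ) ^ (n + 2))⁻¹ :=
        (Finset.abs_sum_le_sum_abs _ _).trans (Finset.sum_le_sum hterm)
    _ = (K : ℝ)⁻¹ := by
        rw [Finset.sum_const, Finset.card_range, nsmul_eq_mul]; push_cast; field_simp; ring

/-- The common finite box cancels, leaving a difference of tails with equal limits. -/
theorem tendsto_sum_lambertKernel_sub (n : ℕ) :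
    Tendsto (fun K : ℕ =>
        ∑ k ∈ Finset.range K, ∑' i : ℕ, lambertKernel n ((k : ℝ) + 1) ((i : ℝ) + 1) -
        ∑ m ∈ Finset.range (K ^ (n + 1)), ∑' i : ℕ, lambertKernel n ((i : ℝ) + 1) ((m : ℝ) + 1))
      atTop (𝓝 0) := by
  have h := (tendsto_sum_lambertKernel_row_tail n).sub (tendsto_sum_lambertKernel_column_tail n)
  rw [sub_self] at h
  refine h.congr fun K => ?_
  have h1 : ∀ k ∈ Finset.range K, ∑' i : ℕ, lambertKernel n ((k : ℝ) + 1) ((i : ℝ) + 1) =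
      ∑ m ∈ Finset.range (K ^ (n + 1)), lambertKernel n ((k : ℝ) + 1) ((m : ℝ) + 1) +
        ∑' i : ℕ, lambertKernel n ((k : ℝ) + 1) ((K : ℝ) ^ (n + 1) + i + 1) := by
    intro k _
    rw [← (summable_lambertKernel_row n (by positivity : (0 : ℝ) < (k : ℝ) + 1)).sum_add_tsum_nat_add
      (K ^ (n + 1))]
    congr 2
    ext i; push_cast; ring_nf
  have h2 : ∀ m ∈ Finset.range (K ^ (n + 1)),
      ∑' i : ℕ, lambertKernel n ((i : ℝ) + 1) ((m : ℝ) + 1) =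
      ∑ k ∈ Finset.range K, lambertKernel n ((k : ℝ) + 1) ((m : ℝ) + 1) +
        ∑' i : ℕ, lambertKernel n ((K : ℝ) + i + 1) ((m : ℝ) + 1) := by
    intro m _
    rw [← (summable_lambertKernel_column n
      (by positivity : (0 : ℝ) < (m : ℝ) + 1)).sum_add_tsum_nat_add K]
    congr 2
    ext i; push_cast; ring_nf
  rw [Finset.sum_congr rfl h1, Finset.sum_congr rfl h2, Finset.sum_add_distrib,
    Finset.sum_add_distrib, Finset.sum_comm]
  ring

/-! ### Partial fractions: the cotangent and roots of unity. -/

/-- This is the cotangent expansion at `i * z`, multiplied by `i / 2`. -/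
theorem hasSum_div_sq_add_sq {z : ℂ} (hz : 0 < z.re) :
    HasSum (fun k : ℕ => z / (z ^ 2 + ((k : ℂ) + 1) ^ 2))
      (Real.pi * (1 / (Complex.exp (2 * Real.pi * z) - 1) + 1 / 2 - 1 / (2 * Real.pi * z))) := by
  have hpi : (Real.pi : ℂ) ≠ 0 := by exact_mod_cast Real.pi_ne_zero
  have hz0 : z ≠ 0 := by rintro rfl; simp at hz
  have hx : Complex.I * z ∈ Complex.integerComplement := by
    rw [Complex.mem_integerComplement_iff]
    rintro ⟨n, hn⟩
    have := congrArg Complex.im hn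
    simp at this
    linarith
  have h := ((summable_cotTerm hx).hasSum).mul_left (Complex.I / 2)
  have hval : ∑' n : ℕ, cotTerm (Complex.I * z) n =
      Real.pi * Complex.cot (Real.pi * (Complex.I * z)) - 1 / (Complex.I * z) :=
    (cot_series_rep' hx).symm
  rw [hval, Complex.cot_pi_eq_exp_ratio] at h
  have hE : Complex.exp (2 * Real.pi * Complex.I * (Complex.I * z)) =
      (Complex.exp (2 * Real.pi * z))⁻¹ := by
    rw [← Complex.exp_neg]
    congr 1
    linear_combination (2 * Real.pi * z) * Complex.I_mul_I
  rw [hE] at h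
  have he0 := Complex.exp_ne_zero (2 * Real.pi * z)
  have he1 : Complex.exp (2 * Real.pi * z) - 1 ≠ 0 := by
    intro h0
    have := congrArg norm (sub_eq_zero.mp h0)
    rw [Complex.norm_exp, norm_one, Real.exp_eq_one_iff] at this
    have h2 : (2 * (Real.pi : ℂ) * z).re = 2 * Real.pi * z.re := by
      have : 2 * (Real.pi : ℂ) * z = ((2 * Real.pi : ℝ) : ℂ) * z := by push_cast; ring
      rw [this, Complex.re_ofReal_mul]
    rw [h2] at this
    have := Real.pi_pos
    have : 0 < 2 * Real.pi * z.re := by positivity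
    linarith
  convert! h using 1
  · ext k
    rw [cotTerm_identity hx]
    have h1 := Complex.integerComplement_add_ne_zero hx ((k : ℤ) + 1)
    have h2 := Complex.integerComplement_add_ne_zero hx (-((k : ℤ) + 1))
    push_cast at h1 h2
    have h3 : (Complex.I * z + (k + 1)) * (Complex.I * z - (k + 1)) =
        -(z ^ 2 + ((k : ℂ) + 1) ^ 2) := by
      linear_combination z ^ 2 * Complex.I_mul_I
    have h4 : z ^ 2 + ((k : ℂ) + 1) ^ 2 ≠ 0 := by
      intro h0
      rw [h0, neg_zero] at h3
      exact mul_ne_zero h1 (by simpa [sub_eq_add_neg] using h2) h3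
    rw [h3]
    field_simp
    linear_combination Complex.I_sq
  · set e := Complex.exp (2 * Real.pi * z)
    have h1 : (1 : ℂ) - e⁻¹ ≠ 0 := by
      intro h0
      apply he1
      have : e * (1 - e⁻¹) = 0 := by rw [h0, mul_zero]
      rwa [mul_sub, mul_one, mul_inv_cancel₀ he0] at this
    have h2 : (e⁻¹ + 1) / (Complex.I * (1 - e⁻¹)) = (1 + e) / (Complex.I * (e - 1)) := by
      have : (1 : ℂ) - e⁻¹ = (e - 1) / e := by field_simp
      rw [this]
      field_simp
    rw [h2]
    have hI := Complex.I_ne_zero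
    field_simp
    ring

theorem IsPrimitiveRoot.sum_pow_mul_eq {R : Type*} [CommRing R] [IsDomain R] {ζ : R} {N : ℕ}
    (hζ : IsPrimitiveRoot ζ N) (s : ℕ) :
    ∑ j ∈ Finset.range N, ζ ^ (j * s) = if N ∣ s then (N : R) else 0 := by
  simp_rw [mul_comm _ s, pow_mul]
  split_ifs with h
  · rw [(hζ.pow_eq_one_iff_dvd s).mpr h]; simp
  · have h1 : (∑ j ∈ Finset.range N, (ζ ^ s) ^ j) * (ζ ^ s - 1) = 0 := by
      rw [geom_sum_mul, ← pow_mul, mul_comm s, pow_mul, hζ.pow_eq_one, one_pow, sub_self]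
    refine (mul_eq_zero.mp h1).resolve_right fun h2 => h ?_
    exact (hζ.pow_eq_one_iff_dvd s).mp (sub_eq_zero.mp h2)

/-- The common denominator is `r ^ 2 * ζ ^ j + y ^ 2` times a geometric sum that does not involve
division. Orthogonality of the powers of `ζ` then selects one term. -/
theorem IsPrimitiveRoot.sum_partial_fractions {K : Type*} [Field K] {ζ : K} {l : ℕ}
    (hζ : IsPrimitiveRoot ζ (2 * l + 1)) {r y : K}
    (hD : y ^ (2 * (2 * l) + 2) + (r ^ (2 * l + 1)) ^ 2 ≠ 0) :
    ∑ j ∈ Finset.range (2 * l + 1), ζ ^ (j * (l + 1)) * r / (r ^ 2 * ζ ^ j + y ^ 2) =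
      (2 * l + 1) * (-1) ^ l * r ^ (2 * l + 1) *
        (y ^ (2 * l) / (y ^ (2 * (2 * l) + 2) + (r ^ (2 * l + 1)) ^ 2)) := by
  set D := y ^ (2 * (2 * l) + 2) + (r ^ (2 * l + 1)) ^ 2 with hDdef
  have hgeom : ∀ j, (∑ i ∈ Finset.range (2 * l + 1),
      (-(r ^ 2 * ζ ^ j)) ^ i * (y ^ 2) ^ (2 * l - i)) * (r ^ 2 * ζ ^ j + y ^ 2) = D := by
    intro j
    have h := geom_sum₂_mul (-(r ^ 2 * ζ ^ j)) (y ^ 2) (2 * l + 1)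
    have h1 : (-(r ^ 2 * ζ ^ j)) ^ (2 * l + 1) = -(r ^ (2 * l + 1)) ^ 2 := by
      rw [Odd.neg_pow ⟨l, rfl⟩, mul_pow, ← pow_mul ζ, mul_comm j, pow_mul ζ, hζ.pow_eq_one]
      ring
    rw [h1, Nat.add_sub_cancel] at h
    rw [hDdef]
    linear_combination -h
  have hterm : ∀ j, ζ ^ (j * (l + 1)) * r / (r ^ 2 * ζ ^ j + y ^ 2) =
      ∑ i ∈ Finset.range (2 * l + 1),
        (r / D * (-(r ^ 2)) ^ i * (y ^ 2) ^ (2 * l - i)) * ζ ^ (j * (l + 1 + i)) := by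
    intro j
    have h0 : r ^ 2 * ζ ^ j + y ^ 2 ≠ 0 := by
      intro h0
      have := hgeom j
      rw [h0, mul_zero] at this
      exact hD this.symm
    rw [div_eq_iff h0]
    have h1 : ∑ i ∈ Finset.range (2 * l + 1),
        (r / D * (-(r ^ 2)) ^ i * (y ^ 2) ^ (2 * l - i)) * ζ ^ (j * (l + 1 + i)) =
        ζ ^ (j * (l + 1)) * r / D * ∑ i ∈ Finset.range (2 * l + 1),
          (-(r ^ 2 * ζ ^ j)) ^ i * (y ^ 2) ^ (2 * l - i) := by
      rw [Finset.mul_sum]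
      refine Finset.sum_congr rfl fun i _ => ?_
      rw [mul_add j, pow_add, pow_mul ζ j i, ← neg_mul, mul_pow]
      ring
    rw [h1, mul_assoc, hgeom j, div_mul_cancel₀ _ hD]
  simp_rw [hterm]
  -- For `0 ≤ i ≤ 2l`, divisibility of `l + 1 + i` by `2l + 1` forces `i = l`.
  rw [Finset.sum_comm]
  simp_rw [← Finset.mul_sum, hζ.sum_pow_mul_eq]
  rw [Finset.sum_eq_single l]
  · have h1 : 2 * l + 1 ∣ l + 1 + l := ⟨1, by ring⟩
    have h2 : 2 * l - l = l := by omega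
    rw [if_pos h1, h2]
    push_cast
    rw [neg_pow]
    ring
  · intro i hi hil
    have hi' := Finset.mem_range.mp hi
    rw [if_neg, mul_zero]
    rintro ⟨c, hc⟩
    have hc2 : c < 2 := by
      by_contra hcon
      have : (2 * l + 1) * 2 ≤ (2 * l + 1) * c := Nat.mul_le_mul_left _ (by omega)
      omega
    interval_cases c <;> omega
  · intro h
    exact absurd (Finset.mem_range.mpr (by omega)) h

/-- The powers of `ζ` with exponents `j` and `2l + 1 - j` are conjugate and are paired. This is why
only the angles with `j ≤ l` are needed. -/
theorem sum_range_eq_add_two_mul_sum_re {φ : ℂ → ℂ}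
    (hφ : ∀ w, φ (starRingEnd ℂ w) = starRingEnd ℂ (φ w)) {ζ : ℂ} {l : ℕ}
    (hζ : ζ ^ (2 * l + 1) = 1) :
    ∑ j ∈ Finset.range (2 * l + 1), φ (ζ ^ j) =
      φ 1 + ((2 * ∑ j ∈ Finset.range l, (φ (ζ ^ (j + 1))).re : ℝ) : ℂ) := by
  have hnorm : ‖ζ‖ = 1 := Complex.norm_eq_one_of_pow_eq_one hζ (by omega)
  have hconj : ∀ j, j ≤ 2 * l + 1 → ζ ^ (2 * l + 1 - j) = starRingEnd ℂ (ζ ^ j) := by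
    intro j hj
    have h1 : ζ ^ (2 * l + 1 - j) * ζ ^ j = 1 := by rw [← pow_add, Nat.sub_add_cancel hj, hζ]
    have h2 : starRingEnd ℂ (ζ ^ j) * ζ ^ j = 1 := by
      rw [mul_comm, Complex.mul_conj, Complex.normSq_eq_norm_sq, norm_pow, hnorm]; simp
    have h3 : ζ ^ j ≠ 0 := by rintro h; simp [h] at h1
    exact mul_right_cancel₀ h3 (h1.trans h2.symm)
  rw [Finset.sum_range_succ', pow_zero, add_comm, two_mul l, Finset.sum_range_add,
    ← Finset.sum_range_reflect (fun x => φ (ζ ^ (l + x + 1))), ← Finset.sum_add_distrib]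
  congr 1
  push_cast
  rw [Finset.mul_sum]
  refine Finset.sum_congr rfl fun j hj => ?_
  have hj' := Finset.mem_range.mp hj
  have h1 : l + (l - 1 - j) + 1 = 2 * l + 1 - (j + 1) := by omega
  rw [h1, hconj (j + 1) (by omega), hφ, Complex.add_conj, Complex.ofReal_mul, Complex.ofReal_ofNat]

theorem one_add_two_mul_sum_neg_one_pow (l : ℕ) :
    (1 : ℝ) + 2 * ∑ j ∈ Finset.range l, (-1 : ℝ) ^ (j + 1) = (-1) ^ l := by
  induction l with
  | zero => simp
  | succ l ih =>
    rw [Finset.sum_range_succ, mul_add, ← add_assoc, ih]; ring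

/-- The term of index `m` in `lambertTwo l j`, apart from the factor `1 / m`,
as a function of the real root `r` of `m`. -/
noncomputable def lambertTwoTerm (l j : ℕ) (r : ℝ) : ℝ :=
  (1 / (Complex.exp (2 * (Real.pi : ℂ) * (r : ℂ) *
      Complex.exp (Complex.I * (Real.pi : ℂ) * (j : ℂ) / (2 * (l : ℂ) + 1))) - 1)).re

/-- The cotangent expansion is applied at `r * ω ^ j`. Since `ω ^ (2l+1) = -1`, the alternating
signs become powers of `ζ = ω ^ 2`, and root-of-unity sums evaluate each part. -/
theorem alternating_sum_lambertTwoTerm {l : ℕ} (hl : 1 ≤ l) {r : ℝ} (hr : 0 < r) :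
    (-1) ^ l * (lambertTwoTerm l 0 r +
        2 * ∑ j ∈ Finset.range l, (-1) ^ (j + 1) * lambertTwoTerm l (j + 1) r) =
      -(1 / 2) + (2 * l + 1) * r ^ (2 * l + 1) / Real.pi *
        ∑' k : ℕ, lambertKernel (2 * l) ((k : ℝ) + 1) (r ^ (2 * l + 1)) := by
  have hN : (2 * (l : ℂ) + 1) ≠ 0 := by exact_mod_cast (by omega : 2 * l + 1 ≠ 0)
  set ω : ℂ := Complex.exp (Complex.I * Real.pi / (2 * (l : ℂ) + 1)) with hω
  have hω0 : ω ≠ 0 := Complex.exp_ne_zero _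
  have hωj : ∀ j : ℕ, Complex.exp (Complex.I * (Real.pi : ℂ) * (j : ℂ) / (2 * (l : ℂ) + 1)) =
      ω ^ j := by
    intro j
    rw [hω, ← Complex.exp_nat_mul]
    congr 1; ring
  have hωN : ω ^ (2 * l + 1) = -1 := by
    rw [hω, ← Complex.exp_nat_mul, ← Complex.exp_pi_mul_I]
    congr 1; push_cast; field_simp
  set ζ : ℂ := ω ^ 2 with hζdef
  have hζ : IsPrimitiveRoot ζ (2 * l + 1) := by
    have := Complex.isPrimitiveRoot_exp (2 * l + 1) (by omega)
    convert! this using 1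
    rw [hζdef, hω, ← Complex.exp_nat_mul]
    congr 1; push_cast; ring
  have hre : ∀ j : ℕ, j ≤ l → 0 < ((r : ℂ) * ω ^ j).re := by
    intro j hj
    rw [Complex.re_ofReal_mul, ← hωj]
    have : Complex.I * (Real.pi : ℂ) * (j : ℂ) / (2 * (l : ℂ) + 1) =
        ((Real.pi * j / (2 * l + 1) : ℝ) : ℂ) * Complex.I := by push_cast; ring
    rw [this, Complex.exp_ofReal_mul_I_re]
    refine mul_pos hr (Real.cos_pos_of_mem_Ioo ⟨?_, ?_⟩)
    · have : 0 ≤ Real.pi * j / (2 * l + 1) := by positivity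
      linarith [Real.pi_pos]
    · rw [div_lt_div_iff₀ (by positivity) (by norm_num)]
      have : (j : ℝ) ≤ l := by exact_mod_cast hj
      nlinarith [Real.pi_pos]
  have hneg : ∀ j : ℕ, (-1 : ℂ) ^ j * ω ^ j = ζ ^ (j * (l + 1)) := by
    intro j
    rw [← hωN, hζdef, ← pow_mul, ← pow_mul, ← pow_add]
    congr 1; ring
  have hinv : ∀ j : ℕ, (-1 : ℂ) ^ j * (ω ^ j)⁻¹ = ζ ^ (j * l) := by
    intro j
    rw [mul_inv_eq_iff_eq_mul₀ (pow_ne_zero _ hω0), ← hωN, hζdef, ← pow_mul, ← pow_mul, ← pow_add]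
    congr 1; ring
  have hcast : ∀ (j : ℕ) (w : ℂ), (-1 : ℝ) ^ j * w.re = ((-1 : ℂ) ^ j * w).re := by
    intro j w
    have : (-1 : ℂ) ^ j = (((-1 : ℝ) ^ j : ℝ) : ℂ) := by push_cast; rfl
    rw [this, Complex.re_ofReal_mul]
  have hsumj : ∀ j : ℕ, j ≤ l →
      HasSum (fun k : ℕ => (((r : ℂ) * ω ^ j) / (((r : ℂ) * ω ^ j) ^ 2 + ((k : ℂ) + 1) ^ 2)).re)
        (Real.pi * (lambertTwoTerm l j r + 1 / 2 - (1 / (2 * Real.pi * r)) * ((ω ^ j)⁻¹).re)) := by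
    intro j hj
    have h := Complex.hasSum_re (hasSum_div_sq_add_sq (hre j hj))
    convert! h using 1
    rw [Complex.re_ofReal_mul, Complex.sub_re, Complex.add_re, lambertTwoTerm, hωj]
    congr 1
    have h1 : (1 : ℂ) / (2 * Real.pi * (r * ω ^ j)) =
        ((1 / (2 * Real.pi * r) : ℝ) : ℂ) * (ω ^ j)⁻¹ := by
      push_cast
      rw [← mul_assoc, ← div_div, div_eq_mul_inv _ (ω ^ j)]
    rw [h1, Complex.re_ofReal_mul, mul_assoc (2 * (Real.pi : ℂ))]
    norm_num
  have hW := (hsumj 0 (by omega)).add ((hasSum_sum (s := Finset.range l) (fun j hj =>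
    (hsumj (j + 1) (Finset.mem_range.mp hj)).mul_left ((-1) ^ (j + 1)))).mul_left 2)
  -- The polar terms cancel because `0 < l < 2l + 1`; this fails for `l = 0`.
  have hzero : 1 + 2 * ∑ j ∈ Finset.range l, (-1) ^ (j + 1) * ((ω ^ (j + 1))⁻¹).re = 0 := by
    have h1 := sum_range_eq_add_two_mul_sum_re (φ := fun w => w ^ l)
      (fun w => (map_pow _ _ _).symm) hζ.pow_eq_one
    simp_rw [← pow_mul] at h1
    rw [hζ.sum_pow_mul_eq, if_neg (Nat.not_dvd_of_pos_of_lt hl (by omega)), one_pow] at h1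
    have h2 : ∀ j ∈ Finset.range l, (-1 : ℝ) ^ (j + 1) * ((ω ^ (j + 1))⁻¹).re =
        (ζ ^ ((j + 1) * l)).re := fun j _ => by rw [hcast, hinv]
    rw [Finset.sum_congr rfl h2]
    exact_mod_cast h1.symm
  have hkernel : ∀ k : ℕ, (((r : ℂ) * ω ^ 0) / (((r : ℂ) * ω ^ 0) ^ 2 + ((k : ℂ) + 1) ^ 2)).re +
      2 * ∑ j ∈ Finset.range l, (-1) ^ (j + 1) *
        (((r : ℂ) * ω ^ (j + 1)) / (((r : ℂ) * ω ^ (j + 1)) ^ 2 + ((k : ℂ) + 1) ^ 2)).re =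
      ((2 * l + 1) * (-1) ^ l * r ^ (2 * l + 1)) *
        lambertKernel (2 * l) ((k : ℝ) + 1) (r ^ (2 * l + 1)) := by
    intro k
    have hD : ((k : ℂ) + 1) ^ (2 * (2 * l) + 2) + ((r : ℂ) ^ (2 * l + 1)) ^ 2 ≠ 0 := by
      have : ((k : ℝ) + 1) ^ (2 * (2 * l) + 2) + (r ^ (2 * l + 1)) ^ 2 ≠ 0 := by positivity
      exact_mod_cast this
    have h1 := hζ.sum_partial_fractions hD
    have h2 := sum_range_eq_add_two_mul_sum_re
      (φ := fun w => w ^ (l + 1) * (r : ℂ) / ((r : ℂ) ^ 2 * w + ((k : ℂ) + 1) ^ 2))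
      (fun w => by simp [map_div₀]) hζ.pow_eq_one
    simp only [← pow_mul, one_pow, one_mul, mul_one] at h2
    rw [h1] at h2
    have h3 : ∀ j ∈ Finset.range l, (-1 : ℝ) ^ (j + 1) *
        (((r : ℂ) * ω ^ (j + 1)) / (((r : ℂ) * ω ^ (j + 1)) ^ 2 + ((k : ℂ) + 1) ^ 2)).re =
        (ζ ^ ((j + 1) * (l + 1)) * (r : ℂ) /
          ((r : ℂ) ^ 2 * ζ ^ (j + 1) + ((k : ℂ) + 1) ^ 2)).re := by
      intro j _
      rw [hcast, ← hneg]
      congr 1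
      have : ((r : ℂ) * ω ^ (j + 1)) ^ 2 = (r : ℂ) ^ 2 * ζ ^ (j + 1) := by rw [hζdef]; ring
      rw [this]; ring
    rw [Finset.sum_congr rfl h3]
    have h4 : (r : ℂ) / ((r : ℂ) ^ 2 + ((k : ℂ) + 1) ^ 2) =
        ((r / (r ^ 2 + ((k : ℝ) + 1) ^ 2) : ℝ) : ℂ) := by push_cast; rfl
    rw [pow_zero, mul_one, h4, Complex.ofReal_re]
    rw [h4] at h2
    unfold lambertKernel
    exact_mod_cast h2.symm
  have hval := hW.tsum_eq
  rw [tsum_congr hkernel, tsum_mul_left] at hval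
  have hsplit : Real.pi * (lambertTwoTerm l 0 r + 1 / 2 -
        (1 / (2 * Real.pi * r)) * ((ω ^ 0)⁻¹).re) +
      2 * ∑ j ∈ Finset.range l, (-1) ^ (j + 1) * (Real.pi * (lambertTwoTerm l (j + 1) r + 1 / 2 -
        (1 / (2 * Real.pi * r)) * ((ω ^ (j + 1))⁻¹).re)) =
      Real.pi * ((lambertTwoTerm l 0 r +
        2 * ∑ j ∈ Finset.range l, (-1) ^ (j + 1) * lambertTwoTerm l (j + 1) r) +
        1 / 2 * (1 + 2 * ∑ j ∈ Finset.range l, (-1 : ℝ) ^ (j + 1)) - (1 / (2 * Real.pi * r)) *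
        (1 + 2 * ∑ j ∈ Finset.range l, (-1) ^ (j + 1) * ((ω ^ (j + 1))⁻¹).re)) := by
    have h1 : ∑ j ∈ Finset.range l, (-1) ^ (j + 1) * (Real.pi * (lambertTwoTerm l (j + 1) r + 1 / 2 -
        (1 / (2 * Real.pi * r)) * ((ω ^ (j + 1))⁻¹).re)) =
        Real.pi * (∑ j ∈ Finset.range l, (-1) ^ (j + 1) * lambertTwoTerm l (j + 1) r) +
        Real.pi / 2 * (∑ j ∈ Finset.range l, (-1 : ℝ) ^ (j + 1)) -
        Real.pi * (1 / (2 * Real.pi * r)) *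
          ∑ j ∈ Finset.range l, (-1) ^ (j + 1) * ((ω ^ (j + 1))⁻¹).re := by
      rw [Finset.mul_sum, Finset.mul_sum, Finset.mul_sum, ← Finset.sum_add_distrib,
        ← Finset.sum_sub_distrib]
      exact Finset.sum_congr rfl fun j _ => by ring
    rw [h1]
    simp only [pow_zero, inv_one, Complex.one_re]
    ring
  rw [hsplit, hzero, one_add_two_mul_sum_neg_one_pow, mul_zero, sub_zero] at hval
  have hsq : ((-1 : ℝ) ^ l) * (-1) ^ l = 1 := by rw [← mul_pow]; simp
  have hpi := Real.pi_ne_zero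
  set W := lambertTwoTerm l 0 r +
    2 * ∑ j ∈ Finset.range l, (-1) ^ (j + 1) * lambertTwoTerm l (j + 1) r
  set S := ∑' k : ℕ, lambertKernel (2 * l) ((k : ℝ) + 1) (r ^ (2 * l + 1))
  have h5 : (2 * l + 1) * r ^ (2 * l + 1) * S = Real.pi * ((-1) ^ l * W + 1 / 2) := by
    linear_combination (-1) ^ l * hval -
      ((2 * l + 1) * r ^ (2 * l + 1) * S - Real.pi * (1 / 2)) * hsq
  rw [div_mul_eq_mul_div, h5]
  field_simp
  ring

/-! ### The relation between the two families and `γ`. -/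

theorem tendsto_sum_range_succPNat {f : ℕ+ → ℝ} (hf : Summable f) :
    Tendsto (fun K : ℕ => ∑ k ∈ Finset.range K, f k.succPNat) atTop (𝓝 (∑' n, f n)) := by
  have h := (Equiv.pnatEquivNat.symm.hasSum_iff (f := f)).mpr hf.hasSum
  exact h.tendsto_sum_nat

/-- The cotangent expansion at `z = x ^ (2l+1)`, whose terms are `x` times the kernel. -/
theorem one_div_mul_exp_sub_one_eq (l : ℕ) {x : ℝ} (hx : 0 < x) :
    1 / (x * (Real.exp (2 * Real.pi * x ^ (2 * l + 1)) - 1)) =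
      1 / Real.pi * ∑' m : ℕ, lambertKernel (2 * l) x ((m : ℝ) + 1) - 1 / 2 * (1 / x) +
        1 / (2 * Real.pi) * (1 / x ^ (2 * l + 2)) := by
  have hz : 0 < ((x ^ (2 * l + 1) : ℝ) : ℂ).re := by rw [Complex.ofReal_re]; positivity
  have h := hasSum_div_sq_add_sq hz
  have h' : HasSum (fun m : ℕ => x * lambertKernel (2 * l) x ((m : ℝ) + 1))
      (Real.pi * (1 / (Real.exp (2 * Real.pi * x ^ (2 * l + 1)) - 1) + 1 / 2 -
        1 / (2 * Real.pi * x ^ (2 * l + 1)))) := by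
    rw [← Complex.hasSum_ofReal]
    convert! h using 1
    · ext m
      unfold lambertKernel
      push_cast
      rw [← mul_div_assoc]
      congr 1 <;> ring
    · push_cast; rfl
  have h2 := h'.tsum_eq
  rw [tsum_mul_left] at h2
  have h3 : ∑' m : ℕ, lambertKernel (2 * l) x ((m : ℝ) + 1) =
      (Real.pi * (1 / (Real.exp (2 * Real.pi * x ^ (2 * l + 1)) - 1) + 1 / 2 -
        1 / (2 * Real.pi * x ^ (2 * l + 1)))) / x := by
    rw [eq_div_iff hx.ne', mul_comm, h2]
  have he : Real.exp (2 * Real.pi * x ^ (2 * l + 1)) - 1 ≠ 0 := by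
    have h4 : 0 < 2 * Real.pi * x ^ (2 * l + 1) := by have := Real.pi_pos; positivity
    have := Real.add_one_lt_exp h4.ne'
    linarith
  have hpi := Real.pi_ne_zero
  rw [h3]
  set E := Real.exp (2 * Real.pi * x ^ (2 * l + 1)) - 1
  field_simp
  ring

theorem lambertTwo_eq_tsum (l j : ℕ) : lambertTwo l j =
    ∑' n : ℕ+, 1 / (n : ℝ) * lambertTwoTerm l j ((n : ℝ) ^ (1 / (2 * (l : ℝ) + 1))) := rfl

theorem tendsto_sum_lambertTwo {l j : ℕ} (hj : j ≤ l) :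
    Tendsto (fun K : ℕ => ∑ m ∈ Finset.range K, 1 / ((m : ℝ) + 1) *
      lambertTwoTerm l j (((m : ℝ) + 1) ^ (1 / (2 * (l : ℝ) + 1)))) atTop (𝓝 (lambertTwo l j)) := by
  have h := tendsto_sum_range_succPNat (summable_lambertTwo l j hj)
  simpa [lambertTwo_eq_tsum, lambertTwoTerm] using h

theorem tendsto_sum_lambertOne (l : ℕ) :
    Tendsto (fun K : ℕ => ∑ k ∈ Finset.range K,
      1 / (((k : ℝ) + 1) * (Real.exp (2 * Real.pi * ((k : ℝ) + 1) ^ (2 * l + 1)) - 1)))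
      atTop (𝓝 (lambertOne l)) := by
  have h := tendsto_sum_range_succPNat (summable_lambertOne l)
  simpa [lambertOne] using h

/-- The alternating combination of the values `lambertTwo l j`. -/
noncomputable def alternatingLambert (l : ℕ) : ℝ :=
  lambertTwo l 0 + 2 * ∑ j ∈ Finset.range l, (-1) ^ (j + 1) * lambertTwo l (j + 1)

theorem tendsto_sum_alternatingLambert {l : ℕ} (hl : 1 ≤ l) :
    Tendsto (fun K : ℕ => ∑ m ∈ Finset.range K, (1 / Real.pi *
        ∑' k : ℕ, lambertKernel (2 * l) ((k : ℝ) + 1) ((m : ℝ) + 1) -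
          1 / (2 * (2 * l + 1)) * (1 / ((m : ℝ) + 1))))
      atTop (𝓝 ((-1) ^ l / (2 * l + 1) * alternatingLambert l)) := by
  have h := ((tendsto_sum_lambertTwo (Nat.zero_le l)).add ((tendsto_finsetSum (Finset.range l)
    (fun j hj => (tendsto_sum_lambertTwo (l := l) (j := j + 1)
      (Finset.mem_range.mp hj)).const_mul ((-1) ^ (j + 1)))).const_mul 2)).const_mul
        ((-1) ^ l / (2 * (l : ℝ) + 1))
  refine h.congr fun K => ?_
  simp_rw [Finset.mul_sum]
  rw [Finset.sum_comm, ← Finset.sum_add_distrib, Finset.mul_sum]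
  refine Finset.sum_congr rfl fun m _ => ?_
  have hm : (0 : ℝ) < (m : ℝ) + 1 := by positivity
  have hl0 : (0 : ℝ) < 2 * l + 1 := by positivity
  set r : ℝ := ((m : ℝ) + 1) ^ (1 / (2 * (l : ℝ) + 1)) with hr
  have hr0 : 0 < r := Real.rpow_pos_of_pos hm _
  have hrn : r ^ (2 * l + 1) = (m : ℝ) + 1 := by
    rw [hr, ← Real.rpow_natCast, ← Real.rpow_mul hm.le]
    push_cast
    rw [one_div_mul_cancel hl0.ne', Real.rpow_one]
  have hmain := alternating_sum_lambertTwoTerm hl hr0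
  rw [hrn] at hmain
  set S := ∑' k : ℕ, lambertKernel (2 * l) ((k : ℝ) + 1) ((m : ℝ) + 1)
  have hpi := Real.pi_ne_zero
  have h1 : ∑ i ∈ Finset.range l, 2 * ((-1) ^ (i + 1) * (1 / ((m : ℝ) + 1) *
      lambertTwoTerm l (i + 1) r)) = 1 / ((m : ℝ) + 1) *
      (2 * ∑ j ∈ Finset.range l, (-1) ^ (j + 1) * lambertTwoTerm l (j + 1) r) := by
    rw [Finset.mul_sum, Finset.mul_sum]
    exact Finset.sum_congr rfl fun j _ => by ring
  rw [h1, ← mul_add]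
  calc _ = 1 / ((2 * l + 1) * ((m : ℝ) + 1)) * ((-1) ^ l * (lambertTwoTerm l 0 r +
        2 * ∑ j ∈ Finset.range l, (-1) ^ (j + 1) * lambertTwoTerm l (j + 1) r)) := by
        field_simp
    _ = _ := by
        rw [hmain]
        field_simp
        ring

theorem tendsto_sum_one_div_sub_log :
    Tendsto (fun K : ℕ => ∑ k ∈ Finset.range K, 1 / ((k : ℝ) + 1) - Real.log K) atTop
      (𝓝 Real.eulerMascheroniConstant) := by
  refine Real.tendsto_harmonic_sub_log.congr fun K => ?_
  simp [harmonic]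

theorem lambertOne_eq {l : ℕ} (hl : 1 ≤ l) :
    lambertOne l = 1 / (2 * Real.pi) * ∑' k : ℕ, 1 / ((k : ℝ) + 1) ^ (2 * l + 2) -
      l / (2 * l + 1) * Real.eulerMascheroniConstant +
      (-1) ^ l / (2 * l + 1) * alternatingLambert l := by
  have hpow : Tendsto (fun K : ℕ => K ^ (2 * l + 1)) atTop atTop :=
    tendsto_pow_atTop (by omega)
  have hzeta : Tendsto (fun K : ℕ => ∑ k ∈ Finset.range K, 1 / ((k : ℝ) + 1) ^ (2 * l + 2)) atTop
      (𝓝 (∑' k : ℕ, 1 / ((k : ℝ) + 1) ^ (2 * l + 2))) := by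
    have h : Summable fun k : ℕ => 1 / ((k : ℝ) + 1) ^ (2 * l + 2) := by
      have := (summable_nat_add_iff 1).mpr
        (Real.summable_one_div_nat_pow.mpr (by omega : 1 < 2 * l + 2))
      simpa using this
    exact h.hasSum.tendsto_sum_nat
  have h1 := tendsto_sum_lambertOne l
  have h2 := (tendsto_sum_alternatingLambert hl).comp hpow
  have h3 := tendsto_sum_one_div_sub_log
  have h4 := tendsto_sum_one_div_sub_log.comp hpow
  have h5 := tendsto_sum_lambertKernel_sub (2 * l)
  have hL := h1.sub h2
  have hR := (((h5.const_mul (1 / Real.pi)).sub (h3.const_mul (1 / 2))).add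
    (h4.const_mul (1 / (2 * (2 * (l : ℝ) + 1))))).add (hzeta.const_mul (1 / (2 * Real.pi)))
  have hl0 : (0 : ℝ) < 2 * l + 1 := by positivity
  have heq := tendsto_nhds_unique hL (hR.congr fun K => ?_)
  · have hg : (l : ℝ) / (2 * l + 1) * Real.eulerMascheroniConstant =
        1 / 2 * Real.eulerMascheroniConstant -
        1 / (2 * (2 * (l : ℝ) + 1)) * Real.eulerMascheroniConstant := by field_simp; ring
    rw [hg]
    linear_combination heq
  · simp only [Function.comp_def]
    rw [Finset.sum_congr rfl fun (k : ℕ) _ =>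
      one_div_mul_exp_sub_one_eq l (x := (k : ℝ) + 1) (by positivity)]
    simp only [Finset.sum_add_distrib, Finset.sum_sub_distrib, ← Finset.mul_sum]
    push_cast
    -- The logarithms cancel: `(1/2) log K` against `log (K ^ (2l+1)) / (2(2l+1))`.
    rw [Real.log_pow]
    push_cast
    field_simp
    ring

/-! ### Powers of `π` and the contradiction. -/

/-- Euler's formula for even zeta values; positivity of the series gives `q ≠ 0` without sign
information on Bernoulli numbers. -/
theorem exists_rat_tsum_one_div_pow (l : ℕ) : ∃ q : ℚ, q ≠ 0 ∧
    1 / (2 * Real.pi) * ∑' k : ℕ, 1 / ((k : ℝ) + 1) ^ (2 * l + 2) = q * Real.pi ^ (2 * l + 1) := by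
  have h := hasSum_zeta_nat (k := l + 1) l.succ_ne_zero
  have hs : ∑' k : ℕ, 1 / ((k : ℝ) + 1) ^ (2 * l + 2) =
      ∑' n : ℕ, 1 / (n : ℝ) ^ (2 * (l + 1)) := by
    rw [h.summable.tsum_eq_zero_add]
    simp [mul_add]
  set q : ℚ := (-1) ^ (l + 1 + 1) * 2 ^ (2 * (l + 1) - 1) * bernoulli (2 * (l + 1)) /
    (2 * (l + 1)).factorial / 2 with hq
  have hval : 1 / (2 * Real.pi) * ∑' k : ℕ, 1 / ((k : ℝ) + 1) ^ (2 * l + 2) =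
      q * Real.pi ^ (2 * l + 1) := by
    rw [hs, h.tsum_eq, hq]
    push_cast
    have := Real.pi_ne_zero
    have h2 : 2 * (l + 1) = 2 * l + 1 + 1 := by ring
    rw [h2, pow_succ Real.pi]
    field_simp
  refine ⟨q, ?_, hval⟩
  intro h0
  rw [hs, h0, Rat.cast_zero, zero_mul] at hval
  have hpos : 0 < ∑' n : ℕ, 1 / (n : ℝ) ^ (2 * (l + 1)) :=
    h.summable.tsum_pos (fun n => by positivity) 1 (by simp)
  have := Real.pi_pos
  have : 0 < 1 / (2 * Real.pi) * ∑' n : ℕ, 1 / (n : ℝ) ^ (2 * (l + 1)) := by positivity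
  linarith

theorem linearIndependent_pow_of_transcendental {F K : Type*} [Field F] [Field K] [Algebra F K]
    {x : K} (hx : Transcendental F x) {e : ℕ → ℕ} (he : Function.Injective e) :
    LinearIndependent F fun i => x ^ e i := by
  have h : LinearIndependent F fun i => x ^ i := by
    have h1 := (Polynomial.basisMonomials F).linearIndependent.map' (Polynomial.aeval x).toLinearMap
      (LinearMap.ker_eq_bot.mpr (transcendental_iff_injective.mp hx))
    convert! h1 using 1
    ext i
    simp
  exact h.comp e he

theorem mainTheorem9 (h : {x : ℝ | x ∈ lambertValues ∧ Transcendental ℚ x}.Finite) :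
    Transcendental ℚ Real.eulerMascheroniConstant := by
  intro hγ
  set F := algebraicClosure ℚ ℝ with hF
  set V : Submodule F ℝ :=
    Submodule.span F (insert 1 {x : ℝ | x ∈ lambertValues ∧ Transcendental ℚ x}) with hV
  have hfin : Module.Finite F V := Module.Finite.span_of_finite F (h.insert 1)
  -- Including `1` among the generators puts every real algebraic number, hence `γ`, in `V`.
  have halg : ∀ x : ℝ, IsAlgebraic ℚ x → x ∈ V := fun x hx => by
    have h1 : (1 : ℝ) ∈ V := Submodule.subset_span (Set.mem_insert _ _)
    have hxF : x ∈ F := (mem_algebraicClosure_iff).mpr hx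
    have := V.smul_mem (⟨x, hxF⟩ : F) h1
    rwa [IntermediateField.smul_def, smul_eq_mul, mul_one] at this
  have hval : ∀ x ∈ lambertValues, x ∈ V := fun x hx => by
    by_cases hxa : IsAlgebraic ℚ x
    · exact halg x hxa
    · exact Submodule.subset_span (Set.mem_insert_of_mem _ ⟨hx, hxa⟩)
  have hrat : ∀ (q : ℚ) (x : ℝ), x ∈ V → (q : ℝ) * x ∈ V := fun q x hx => by
    have := V.smul_mem (algebraMap ℚ F q) hx
    rwa [IntermediateField.smul_def, smul_eq_mul] at this
  have hπV : ∀ l : ℕ, Real.pi ^ (2 * (l + 1) + 1) ∈ V := by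
    intro l
    have hl : 1 ≤ l + 1 := by omega
    have hmem1 : lambertOne (l + 1) ∈ V := hval _ (by
      simp only [lambertValues, Set.mem_iUnion]
      exact ⟨l + 1, hl, Or.inl rfl⟩)
    have hmem2 : ∀ j, j ≤ l + 1 → lambertTwo (l + 1) j ∈ V := fun j hj => hval _ (by
      simp only [lambertValues, Set.mem_iUnion]
      exact ⟨l + 1, hl, Or.inr ⟨j, hj, rfl⟩⟩)
    have halt : alternatingLambert (l + 1) ∈ V := by
      refine V.add_mem (hmem2 0 (Nat.zero_le _)) ?_
      have := hrat 2 (∑ j ∈ Finset.range (l + 1), (-1) ^ (j + 1) * lambertTwo (l + 1) (j + 1))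
        (V.sum_mem fun j hj => by
          have := hrat ((-1) ^ (j + 1)) _ (hmem2 (j + 1) (Finset.mem_range.mp hj))
          push_cast at this
          exact this)
      push_cast at this
      exact this
    obtain ⟨q, hq0, hq⟩ := exists_rat_tsum_one_div_pow (l + 1)
    have hformula := lambertOne_eq hl
    rw [hq] at hformula
    have hg := hrat (((l + 1 : ℕ) : ℚ) / (2 * ((l + 1 : ℕ) : ℚ) + 1)) _ (halg _ hγ)
    have ha := hrat ((-1) ^ (l + 1) / (2 * ((l + 1 : ℕ) : ℚ) + 1)) _ halt
    have hsum := hrat q⁻¹ _ (V.sub_mem (V.add_mem hmem1 hg) ha)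
    convert! hsum using 1
    have hq' : (q : ℝ) ≠ 0 := by exact_mod_cast hq0
    rw [hformula]
    push_cast
    field_simp
    ring
  have hFalg : Algebra.IsAlgebraic ℚ F := algebraicClosure.isAlgebraic ℚ ℝ
  -- Transcendence passes from `ℚ` to `F` because `F` is algebraic over `ℚ`.
  have hπ : Transcendental F Real.pi := transcendental_pi.extendScalars F
  have hli := linearIndependent_pow_of_transcendental hπ (e := fun l => 2 * (l + 1) + 1)
    (fun a b hab => by simpa using hab)
  have hliV : LinearIndependent F fun l : ℕ => (⟨_, hπV l⟩ : V) :=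
    LinearIndependent.of_comp V.subtype hli
  exact absurd hliV.finite (by simpa using not_finite_iff_infinite.mpr (inferInstance : Infinite ℕ))
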